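/- **Lemma 2.1.** Let $n\ge 0$ be an integer, let $y_1,\dots,y_n$ be variables, let $p_1=y_1+\cdots+y_n$, and let $e_k$ be the $k$-th elementary symmetric polynomial in $y_1,\dots,y_n$ (with $e_0=1$). For a partition $\lambda=(\lambda_1\ge\cdots\ge\lambda_n\ge 0)$ of $n$, padded with zeros, let $H_\lambda$ be the product of the hook lengths of all cells of the Young diagram of $\lambda$, let $$A_\lambda(u)=\frac{1}{H_\lambda}\prod_{i=1}^n(\lambda_i+n-i+u),$$ and let $s_\lambda=s_\lambda(y_1,\dots,y_n)$ be the Schur polynomial, that is, the polynomial with $$\prod_{1\le i<j\le n}(y_i-y_j)\cdot s_\lambda=\det\left(y_i^{\lambda_j+n-j}\right)_{i,j=1}^n .$$ Then, for every field $K$ of characteristic zero and every $u\in K$ (for instance $u\in\mathbb C$, or $u$ an indeterminate over $\mathbb Q$ and $K=\mathbb Q(u)$), the following identity holds in $K[y_1,\dots,y_n]$: $$\sum_{i=0}^n\binom{u+i-1}{i}\,p_1^{\,i}\,e_{n-i}=\sum_{\lambda\vdash n}A_\lambda(u)\,s_\lambda ,$$ where $\binom{x}{i}=\frac{x(x-1)\cdots(x-i+1)}{i!}$.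 -/

import Mathlib

/-! ### Partitions of `n`: parts, Young diagram, hook lengths -/

/-- The list of the (positive) parts of a partition, in weakly decreasing order. -/
def sortedParts {n : ℕ} (p : n.Partition) : List ℕ := p.parts.sort (· ≥ ·)

theorem sortedParts_sortedGE {n : ℕ} (p : n.Partition) : (sortedParts p).SortedGE :=
  List.Pairwise.sortedGE (Multiset.pairwise_sort p.parts (· ≥ ·))

/-- The `i`-th largest part of a partition `(λ₁, …, λₙ)` of `n`, padded with zeros at the tail
(indices start at `0`, so that `part p i` is `λ_{i+1}`). -/
def part {n : ℕ} (p : n.Partition) (i : ℕ) : ℕ := (sortedParts p).getD i 0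

/-- The Young diagram of a partition: the cells `(i, j)` with `j < part p i`. -/
def diagram {n : ℕ} (p : n.Partition) : YoungDiagram :=
  YoungDiagram.ofRowLens (sortedParts p) (sortedParts_sortedGE p)

/-- The hook length of a cell `(i, j)` of a Young diagram: the number of cells to its right in the
same row, plus the number of cells below it in the same column, plus one for the cell itself. -/
def hookLength (μ : YoungDiagram) (c : ℕ × ℕ) : ℕ :=
  (μ.rowLen c.1 - (c.2 + 1)) + (μ.colLen c.2 - (c.1 + 1)) + 1

/-- `H_λ`, the product of the hook lengths over all the cells of the Young diagram. -/
def hookProd {n : ℕ} (p : n.Partition) : ℕ :=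
  ∏ c ∈ (diagram p).cells, hookLength (diagram p) c

/-- `φ_λ(u) = ∏_{i=1}^n (λ_i + n - i + u)`; the `0`-based index `i` stands for `i + 1`. -/
def shiftedProd {K : Type*} [Field K] {n : ℕ} (p : n.Partition) (u : K) : K :=
  ∏ i : Fin n, ((part p i : K) + ((n : K) - ((i : ℕ) + 1 : K)) + u)

/-- `A_λ(u) = φ_λ(u) / H_λ`. -/
def shiftedHookRatio {K : Type*} [Field K] {n : ℕ} (p : n.Partition) (u : K) : K :=
  shiftedProd p u / (hookProd p : K)

/-! ### Schur polynomials as quotients of alternants -/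

/-- The Vandermonde product `a_δ = ∏_{i < j} (y_i - y_j)`. -/
noncomputable def vandermondeProd (K : Type*) [Field K] (n : ℕ) : MvPolynomial (Fin n) K :=
  ∏ i : Fin n, ∏ j ∈ Finset.Ioi i, (MvPolynomial.X i - MvPolynomial.X j)

/-- The alternant `a_α = det (y_i ^ α_j)`. -/
noncomputable def alternant (K : Type*) [Field K] {n : ℕ} (α : Fin n → ℕ) :
    MvPolynomial (Fin n) K :=
  (Matrix.of fun i j : Fin n => (MvPolynomial.X i : MvPolynomial (Fin n) K) ^ α j).det

/-- The staircase `δ = (n - 1, n - 2, …, 1, 0)`. -/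
def staircase (n : ℕ) (i : Fin n) : ℕ := n - (i + 1)

/-- The Vandermonde product is the alternant `a_δ` of the staircase. -/
theorem alternant_staircase (K : Type*) [Field K] (n : ℕ) :
    alternant K (staircase n) = vandermondeProd K n := by
  have h := Matrix.det_projVandermonde (fun _ : Fin n => (1 : MvPolynomial (Fin n) K))
    (fun i => MvPolynomial.X i)
  simp only [one_mul] at h
  rw [vandermondeProd, ← h, alternant]
  congr 1
  ext1 i j
  simp [Matrix.projVandermonde_apply, staircase, Fin.val_rev]

theorem X_sub_X_dvd_of_aeval_eq_zero {K : Type*} [Field K] {n : ℕ} (a b : Fin n)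
    (f : MvPolynomial (Fin n) K)
    (h : MvPolynomial.aeval (fun i => if i = a then MvPolynomial.X b else
      (MvPolynomial.X i : MvPolynomial (Fin n) K)) f = 0) :
    (MvPolynomial.X a - MvPolynomial.X b : MvPolynomial (Fin n) K) ∣ f := by
  set s : Fin n → MvPolynomial (Fin n) K :=
    fun i => if i = a then MvPolynomial.X b else MvPolynomial.X i with hs
  have key : ∀ g : MvPolynomial (Fin n) K,
      (MvPolynomial.X a - MvPolynomial.X b : MvPolynomial (Fin n) K) ∣
        g - MvPolynomial.aeval s g := by
    intro g
    induction g using MvPolynomial.induction_on with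
    | C r => simp [MvPolynomial.algebraMap_eq]
    | add p q hp hq =>
      have := dvd_add hp hq
      rw [map_add]
      convert this using 1
      ring
    | mul_X p i hp =>
      have hX : (MvPolynomial.X a - MvPolynomial.X b : MvPolynomial (Fin n) K) ∣
          MvPolynomial.X i - s i := by
        by_cases hi : i = a
        · simp [hs, hi]
        · simp [hs, hi]
      rw [map_mul, MvPolynomial.aeval_X]
      have := dvd_add (hp.mul_right (MvPolynomial.X i))
        (hX.mul_left (MvPolynomial.aeval s p))
      convert this using 1
      ring
  have := key f
  rwa [h, sub_zero] at this

theorem irreducible_X_sub_X {K : Type*} [Field K] {n : ℕ} {a b : Fin n} (hab : a ≠ b) :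
    Irreducible (MvPolynomial.X a - MvPolynomial.X b : MvPolynomial (Fin n) K) := by
  have hne : (MvPolynomial.X a - MvPolynomial.X b : MvPolynomial (Fin n) K) ≠ 0 :=
    sub_ne_zero.mpr fun h => hab (MvPolynomial.X_injective h)
  have hprime : Prime (MvPolynomial.X a - MvPolynomial.X b : MvPolynomial (Fin n) K) := by
    have hev : MvPolynomial.aeval (fun i => if i = a then MvPolynomial.X b else
      (MvPolynomial.X i : MvPolynomial (Fin n) K)) (MvPolynomial.X a - MvPolynomial.X b :
        MvPolynomial (Fin n) K) = 0 := by
      simp [hab.symm]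
    have hz : ∀ g : MvPolynomial (Fin n) K,
        (MvPolynomial.X a - MvPolynomial.X b : MvPolynomial (Fin n) K) ∣ g →
        MvPolynomial.aeval (fun i => if i = a then MvPolynomial.X b else
          (MvPolynomial.X i : MvPolynomial (Fin n) K)) g = 0 := by
      rintro g ⟨q, rfl⟩
      rw [map_mul, hev, zero_mul]
    refine ⟨hne, fun hu => ?_, fun f g hfg => ?_⟩
    · have h1 := hz 1 (isUnit_iff_dvd_one.mp hu)
      simp at h1
    · have h0 := hz _ hfg
      rw [map_mul, mul_eq_zero] at h0
      exact h0.imp (X_sub_X_dvd_of_aeval_eq_zero a b f) (X_sub_X_dvd_of_aeval_eq_zero a b g)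
  exact hprime.irreducible

theorem X_sub_X_dvd_X_sub_X {K : Type*} [Field K] {n : ℕ} {a b c d : Fin n}
    (hab : a < b) (hcd : c < d)
    (h : (MvPolynomial.X a - MvPolynomial.X b : MvPolynomial (Fin n) K) ∣
      MvPolynomial.X c - MvPolynomial.X d) : a = c ∧ b = d := by
  obtain ⟨q, hq⟩ := h
  have h0 := congrArg (MvPolynomial.aeval (fun i => if i = a then MvPolynomial.X b else
      (MvPolynomial.X i : MvPolynomial (Fin n) K))) hq
  simp only [map_sub, map_mul, MvPolynomial.aeval_X, if_true, if_neg hab.ne', sub_self,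
    zero_mul] at h0
  rw [sub_eq_zero] at h0
  split_ifs at h0 with h1 h2 h2
  · exact absurd (h1.trans h2.symm) hcd.ne
  · exact ⟨h1.symm, MvPolynomial.X_injective h0⟩
  · have := MvPolynomial.X_injective h0
    subst h2
    subst this
    exact absurd hcd hab.asymm
  · exact absurd (MvPolynomial.X_injective h0) hcd.ne

/-- Every alternant is divisible by the Vandermonde product. -/
theorem vandermondeProd_dvd_alternant (K : Type*) [Field K] {n : ℕ} (α : Fin n → ℕ) :
    vandermondeProd K n ∣ alternant K α := by
  rw [vandermondeProd, Finset.prod_sigma']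
  refine Finset.prod_dvd_of_isRelPrime ?_ ?_
  · rintro ⟨a, b⟩ hab ⟨c, d⟩ hcd hne
    simp only [Finset.coe_sigma, Set.mem_sigma_iff, Finset.coe_univ, Set.mem_univ, true_and,
      Finset.mem_coe, Finset.mem_Ioi] at hab hcd
    refine (irreducible_X_sub_X hab.ne).isRelPrime_iff_not_dvd.mpr fun h => hne ?_
    obtain ⟨rfl, rfl⟩ := X_sub_X_dvd_X_sub_X hab hcd h
    rfl
  · rintro ⟨a, b⟩ hab
    simp only [Finset.mem_sigma, Finset.mem_univ, true_and, Finset.mem_Ioi] at hab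
    refine X_sub_X_dvd_of_aeval_eq_zero a b _ ?_
    rw [alternant, AlgHom.map_det]
    refine Matrix.det_zero_of_row_eq hab.ne ?_
    ext1 j
    simp [AlgHom.mapMatrix_apply, hab.ne']

/-- The Schur polynomial `s_λ(y_1, …, y_n) = a_{δ+λ} / a_δ`: the polynomial whose product with the
Vandermonde product is the alternant `a_{δ+λ}`. -/
noncomputable def schurPoly (K : Type*) [Field K] {n : ℕ} (p : n.Partition) :
    MvPolynomial (Fin n) K :=
  (vandermondeProd_dvd_alternant K fun i => staircase n i + part p i).choose

/-- The defining property `a_δ s_λ = a_{δ+λ}`; it determines `s_λ`, because the polynomial ring is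
a domain and `a_δ ≠ 0`. -/
theorem vandermondeProd_mul_schurPoly (K : Type*) [Field K] {n : ℕ} (p : n.Partition) :
    vandermondeProd K n * schurPoly K p = alternant K fun i => staircase n i + part p i :=
  (vandermondeProd_dvd_alternant K fun i => staircase n i + part p i).choose_spec.symm

/-! The two sides are compared after multiplication by the Vandermonde determinant
`V(y) = ∏_{i < j} (y_j - y_i)`, one coefficient at a time. Write `(x)_d` for the rising factorial
and `N = 0 + 1 + ⋯ + n`. The claim behind the proof is that, for every exponent vector `m`, the
coefficient of `y^m` on either side is

  `V(m) ∏_i (m_i + u) / ∏_i m_i!` if `∑ m_i = N`, and `0` otherwise.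

*Left-hand side.* The determinant of the values of monic polynomials `p_0, …, p_n` of degrees
`0, …, n` at the points `-t, v_1, …, v_n` is the Vandermonde determinant of these points. Expand it
along the row of `-t` (`sum_eval_mul_det_minor`). This is used twice.
With `p_d = X ^ d` and `t` a variable it shows that `V(y) e_{n-d}` is the alternant with exponents
`{0, …, n} \ {d}` (`det_X_pow_succAbove`). By the multinomial theorem, multiplying a monomial `y^g`
by `p_1 ^ d` and taking `∏ m_i!` times the coefficient of `y^m` gives `d!` times a product of falling
factorials of the `m_i`, so the alternant turns into `d!` times the corresponding minor of falling
factorials, and `d! * choose (u + d - 1) d = (u)_d`. With `p_d` the falling factorials and `t = u`,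
the same expansion sums these minors to `V(m) ∏ (m_i + u)`.

*Right-hand side.* The alternants `a_{δ+λ}` have pairwise disjoint sets of exponents, namely the
rearrangements of `b = δ + λ`, and these are all the injective `m` with `∑ m_i = N`. For `m = b`,
up to the sign between `V` and `∏_{i < j} (y_i - y_j)`, which is the same for `y` and for `m`,
the claim is the hook formula `H_λ ∏_{i < j} (b_i - b_j) = ∏ b_i!`, which holds row by row: the
numbers `b_i - b_j` with `j > i` and the hook lengths in row `i` together are `1, …, b_i`
(`prod_hookLength_row_mul_prod_sub`). -/

/-! ### Minors of Vandermonde type -/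

/-- Laplace expansion, along the row of `-t`, of the determinant of the values at `-t, v_1, …, v_n`
of monic polynomials of degrees `0, …, n`; the determinant equals that of Vandermonde. -/
theorem sum_eval_mul_det_minor {R : Type*} [CommRing R] {n : ℕ} (p : ℕ → Polynomial R)
    (hdeg : ∀ d, (p d).natDegree = d) (hmonic : ∀ d, (p d).Monic) (v : Fin n → R) (t : R) :
    ∑ d : Fin (n + 1), (-1) ^ (d : ℕ) * (p d).eval (-t) *
        (Matrix.of fun r c : Fin n => (p (d.succAbove c)).eval (v r)).det =
      (Matrix.vandermonde v).det * ∏ i, (v i + t) := by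
  have h := Matrix.det_eval_matrixOfPolynomials_eq_det_vandermonde
    (Fin.cons (-t) v : Fin (n + 1) → R) (fun d => p d) (fun d => hdeg d) (fun d => hmonic d)
  rw [Matrix.det_vandermonde, Matrix.det_succ_row_zero, Fin.prod_univ_succ] at h
  rw [Matrix.det_vandermonde]
  simp only [Fin.prod_Ioi_zero, Fin.prod_Ioi_succ, Fin.cons_succ, Fin.cons_zero, sub_neg_eq_add,
    Matrix.of_apply] at h
  rw [mul_comm, h]
  rfl

/-- The product of the Vandermonde determinant and an elementary symmetric polynomial is an alternant
whose exponents are those of `0, …, n` with one left out: compare the coefficients of `t ^ d` in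
`sum_eval_mul_det_minor` for `p d = X ^ d`. -/
theorem det_X_pow_succAbove {R : Type*} [CommRing R] [Nontrivial R] {n : ℕ} (d : Fin (n + 1)) :
    (Matrix.of fun r c : Fin n =>
        (MvPolynomial.X r : MvPolynomial (Fin n) R) ^ (d.succAbove c : ℕ)).det =
      (Matrix.vandermonde (MvPolynomial.X : Fin n → MvPolynomial (Fin n) R)).det *
        MvPolynomial.esymm (Fin n) R (n - d) := by
  have h := sum_eval_mul_det_minor (R := Polynomial (MvPolynomial (Fin n) R))
    (fun k => Polynomial.X ^ k) (fun k => Polynomial.natDegree_X_pow k)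
    (fun k => Polynomial.monic_X_pow k) (fun i => Polynomial.C (MvPolynomial.X i)) Polynomial.X
  have hdet : ∀ e : Fin (n + 1), (Matrix.of fun r c : Fin n =>
        (Polynomial.C (MvPolynomial.X r : MvPolynomial (Fin n) R)) ^ (e.succAbove c : ℕ)).det =
      Polynomial.C (Matrix.of fun r c : Fin n =>
        (MvPolynomial.X r : MvPolynomial (Fin n) R) ^ (e.succAbove c : ℕ)).det := by
    intro e
    rw [RingHom.map_det]
    congr 1
    ext1 r c
    simp
  have hV : (Matrix.vandermonde fun i : Fin n =>
        Polynomial.C (MvPolynomial.X i : MvPolynomial (Fin n) R)).det =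
      Polynomial.C (Matrix.vandermonde
        (MvPolynomial.X : Fin n → MvPolynomial (Fin n) R)).det := by
    rw [RingHom.map_det]
    congr 1
    ext1 r c
    simp [Matrix.vandermonde_apply]
  have hprod : ∏ i : Fin n, (Polynomial.C (MvPolynomial.X i : MvPolynomial (Fin n) R) +
      Polynomial.X) = ∑ j ∈ Finset.range (n + 1), Polynomial.C
        (MvPolynomial.esymm (Fin n) R j) * Polynomial.X ^ (n - j) := by
    simp_rw [add_comm (Polynomial.C _)]
    simpa using MvPolynomial.prod_C_add_X_eq_sum_esymm (σ := Fin n) (R := R)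
  have hX : ∀ k : ℕ, (-1) ^ k * (-Polynomial.X) ^ k =
      (Polynomial.X ^ k : Polynomial (MvPolynomial (Fin n) R)) := fun k => by
    rw [← mul_pow]; congr 1; ring
  simp only [Polynomial.eval_pow, Polynomial.eval_X, hX, hdet, hV, hprod] at h
  have hc := congrArg (fun q => Polynomial.coeff q d) h
  simp only [Polynomial.finsetSum_coeff, Polynomial.coeff_C_mul,
    Polynomial.coeff_mul_C, Polynomial.coeff_X_pow] at hc
  rw [Finset.sum_eq_single d, Finset.sum_eq_single (n - d : ℕ)] at hc
  · have : (d : ℕ) = n - (n - d) := by omega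
    rw [if_pos this] at hc
    simpa using hc
  · intro j hj hne
    rw [if_neg, mul_zero]
    have := Finset.mem_range.mp hj
    omega
  · intro hj
    exact absurd (Finset.mem_range.mpr (by omega)) hj
  · intro e _ hne
    rw [if_neg fun h => hne (Fin.ext h.symm), zero_mul]
  · simp

theorem prod_factorial_mul_coeff_psum_pow_mul_monomial {K : Type*} [Field K] [CharZero K] {n : ℕ}
    (m g : Fin n →₀ ℕ) (d : ℕ) :
    ((∏ i, (m i).factorial : ℕ) : K) * MvPolynomial.coeff m
        (MvPolynomial.psum (Fin n) K 1 ^ d * MvPolynomial.monomial g 1) =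
      if ∑ i, m i = ∑ i, g i + d then
        (d.factorial : K) * ∏ i, ((m i).descFactorial (g i) : K) else 0 := by
  simp only [MvPolynomial.psum, pow_one, MvPolynomial.coeff_mul_monomial',
    MvPolynomial.coeff_sum_X_pow_of_fintype, mul_one]
  rw [Finsupp.sum_fintype _ _ (fun _ => rfl),
    Finsupp.multinomial_eq_of_support_subset (Finset.subset_univ _)]
  by_cases hle : g ≤ m
  · have hsum : ∑ i, (m - g) i + ∑ i, g i = ∑ i, m i := by
      rw [← Finset.sum_add_distrib]
      exact Finset.sum_congr rfl fun i _ => by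
        rw [Finsupp.tsub_apply]; exact Nat.sub_add_cancel (hle i)
    rw [if_pos hle]
    by_cases hd : ∑ i, (m - g) i = d
    · rw [if_pos hd, if_pos (by omega)]
      have h1 := Nat.multinomial_spec Finset.univ (m - g : Fin n →₀ ℕ)
      rw [hd] at h1
      have h2 : ∏ i, (m i).factorial =
          (∏ i, ((m - g : Fin n →₀ ℕ) i).factorial) * ∏ i, (m i).descFactorial (g i) := by
        rw [← Finset.prod_mul_distrib]
        refine Finset.prod_congr rfl fun i _ => ?_
        rw [Finsupp.tsub_apply, Nat.factorial_mul_descFactorial (hle i)]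
      norm_cast
      rw [h2, ← h1]
      ring
    · rw [if_neg hd, if_neg (by omega), Nat.cast_zero, mul_zero]
    -- `y^g` does not divide `y^m`: some falling factorial on the right vanishes.
  · rw [if_neg hle, mul_zero]
    obtain ⟨i, hi⟩ : ∃ i, m i < g i := by
      by_contra! h
      exact hle h
    rw [Finset.prod_eq_zero (Finset.mem_univ i), mul_zero, ite_self]
    rw [Nat.descFactorial_eq_zero_iff_lt.mpr hi, Nat.cast_zero]

/-- The case of `sum_eval_mul_det_minor` where the polynomials are the falling factorials. -/
theorem sum_ascPochhammer_mul_det_descFactorial {K : Type*} [Field K] {n : ℕ}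
    (m : Fin n → ℕ) (u : K) :
    ∑ d : Fin (n + 1), (ascPochhammer K d).eval u *
        (Matrix.of fun r c : Fin n => ((m r).descFactorial (d.succAbove c) : K)).det =
      (Matrix.vandermonde fun i => (m i : K)).det * ∏ i, ((m i : K) + u) := by
  rw [← sum_eval_mul_det_minor (descPochhammer K) (fun d => descPochhammer_natDegree K d)
    (fun d => monic_descPochhammer K d)]
  refine Finset.sum_congr rfl fun d _ => ?_
  rw [← ascPochhammer_eval_neg_eq_descPochhammer, neg_neg]
  simp only [descPochhammer_eval_eq_descFactorial]

theorem factorial_mul_choose_add_sub_one {K : Type*} [Field K] [CharZero K] (u : K) (d : ℕ) :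
    (d.factorial : K) * Ring.choose (u + (d : K) - 1) d = (ascPochhammer K d).eval u := by
  rw [← Ring.multichoose_eq, ← nsmul_eq_mul, Ring.factorial_nsmul_multichoose_eq_ascPochhammer,
    Polynomial.ascPochhammer_smeval_eq_eval]

theorem sum_succAbove_add {n : ℕ} (d : Fin (n + 1)) :
    ∑ c : Fin n, (d.succAbove c : ℕ) + d = ∑ k ∈ Finset.range (n + 1), k := by
  rw [Finset.sum_range, Fin.sum_univ_succAbove _ d, add_comm]

theorem prod_X_pow_perm {R : Type*} [CommRing R] {n : ℕ} (σ : Equiv.Perm (Fin n)) (g : Fin n → ℕ) :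
    ∏ i, (MvPolynomial.X (σ i) : MvPolynomial (Fin n) R) ^ g i =
      MvPolynomial.monomial (Finsupp.equivFunOnFinite.symm fun i => g (σ.symm i)) 1 := by
  rw [MvPolynomial.monomial_eq, Finsupp.prod_fintype _ _ (fun _ => pow_zero _), map_one, one_mul,
    ← Equiv.prod_comp σ (fun i => (MvPolynomial.X i : MvPolynomial (Fin n) R) ^
      (Finsupp.equivFunOnFinite.symm fun i => g (σ.symm i)) i)]
  simp

/-- The coefficients of the left-hand side of the identity, times the Vandermonde determinant. -/
theorem prod_factorial_mul_coeff_vandermonde_mul_sum {K : Type*} [Field K] [CharZero K] {n : ℕ}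
    (u : K) (m : Fin n →₀ ℕ) :
    ((∏ i, (m i).factorial : ℕ) : K) * MvPolynomial.coeff m
        ((Matrix.vandermonde (MvPolynomial.X : Fin n → MvPolynomial (Fin n) K)).det *
          ∑ i ∈ Finset.range (n + 1), Ring.choose (u + (i : K) - 1) i •
            (MvPolynomial.psum (Fin n) K 1 ^ i * MvPolynomial.esymm (Fin n) K (n - i))) =
      if ∑ i, m i = ∑ k ∈ Finset.range (n + 1), k then
        (Matrix.vandermonde fun i => (m i : K)).det * ∏ i, ((m i : K) + u) else 0 := by
  rw [Finset.sum_range, Finset.mul_sum, MvPolynomial.coeff_sum, Finset.mul_sum]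
  have key : ∀ d : Fin (n + 1), ((∏ i, (m i).factorial : ℕ) : K) * MvPolynomial.coeff m
      ((Matrix.vandermonde (MvPolynomial.X : Fin n → MvPolynomial (Fin n) K)).det *
        (Ring.choose (u + ((d : ℕ) : K) - 1) (d : ℕ) •
          (MvPolynomial.psum (Fin n) K 1 ^ (d : ℕ) * MvPolynomial.esymm (Fin n) K (n - d)))) =
      if ∑ i, m i = ∑ k ∈ Finset.range (n + 1), k then (ascPochhammer K d).eval u *
        (Matrix.of fun r c : Fin n => ((m r).descFactorial (d.succAbove c) : K)).det else 0 := by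
    intro d
    have hσ : ∀ σ : Equiv.Perm (Fin n), ((∏ i, (m i).factorial : ℕ) : K) * MvPolynomial.coeff m
        (MvPolynomial.psum (Fin n) K 1 ^ (d : ℕ) * (((Equiv.Perm.sign σ : ℤ) :
          MvPolynomial (Fin n) K) *
            ∏ i, (MvPolynomial.X (σ i) : MvPolynomial (Fin n) K) ^ (d.succAbove i : ℕ))) =
        if ∑ i, m i = ∑ k ∈ Finset.range (n + 1), k then ((d : ℕ).factorial : K) *
          (((Equiv.Perm.sign σ : ℤ) : K) * ∏ i, ((m (σ i)).descFactorial (d.succAbove i) : K))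
        else 0 := by
      intro σ
      have h := prod_factorial_mul_coeff_psum_pow_mul_monomial (K := K) m
        (Finsupp.equivFunOnFinite.symm fun i => (d.succAbove (σ.symm i) : ℕ)) d
      change _ = if ∑ i, m i = ∑ i, (d.succAbove (σ.symm i) : ℕ) + d then (d : ℕ).factorial *
        ∏ i, ((m i).descFactorial (d.succAbove (σ.symm i)) : K) else 0 at h
      rw [Equiv.sum_comp σ.symm (fun i => (d.succAbove i : ℕ)), sum_succAbove_add,
        ← Equiv.prod_comp σ (fun i => ((m i).descFactorial (d.succAbove (σ.symm i)) : K))] at h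
      simp only [Equiv.symm_apply_apply] at h
      rw [prod_X_pow_perm σ (fun i => (d.succAbove i : ℕ)), ← map_intCast (MvPolynomial.C (R := K)),
        mul_left_comm, MvPolynomial.coeff_C_mul, mul_left_comm, h, mul_ite, mul_zero, mul_left_comm]
    rw [mul_smul_comm, mul_left_comm, ← det_X_pow_succAbove, Matrix.det_apply', Finset.mul_sum,
      MvPolynomial.coeff_smul, MvPolynomial.coeff_sum, smul_eq_mul, mul_left_comm, Finset.mul_sum]
    refine (congrArg _ (Finset.sum_congr rfl fun σ _ => hσ σ)).trans ?_
    rw [Finset.sum_ite_irrel, Finset.sum_const_zero, mul_ite,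
      mul_zero, ← Finset.mul_sum, ← mul_assoc, mul_comm (Ring.choose _ _),
      factorial_mul_choose_add_sub_one, Matrix.det_apply']
    rfl
  simp_rw [key]
  split_ifs
  · exact sum_ascPochhammer_mul_det_descFactorial _ _
  · simp

/-! ### Partitions, strictly decreasing vectors and hook lengths -/

theorem rowLen_diagram {n : ℕ} (p : n.Partition) (i : ℕ) : (diagram p).rowLen i = part p i := by
  refine eq_of_forall_lt_iff fun j => ?_
  rw [← YoungDiagram.mem_iff_lt_rowLen, diagram, YoungDiagram.mem_ofRowLens, part]
  by_cases h : i < (sortedParts p).length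
  · simp [h]
  · simp [h]

theorem part_antitone {n : ℕ} (p : n.Partition) : Antitone (part p) := fun i j hij => by
  simpa only [rowLen_diagram] using (diagram p).rowLen_anti i j hij

theorem pos_of_mem_sortedParts {n : ℕ} (p : n.Partition) : ∀ x ∈ sortedParts p, 0 < x :=
  fun _ hx => p.parts_pos ((Multiset.mem_sort _).mp hx)

theorem length_sortedParts_le {n : ℕ} (p : n.Partition) : (sortedParts p).length ≤ n := by
  have h := Multiset.card_nsmul_le_sum (s := p.parts) (a := 1) fun x hx => p.parts_pos hx
  rwa [p.parts_sum, smul_eq_mul, mul_one, ← Multiset.length_sort (r := (· ≥ ·))] at h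

theorem sum_range_getD_eq_sum (l : List ℕ) {n : ℕ} (h : l.length ≤ n) :
    ∑ i ∈ Finset.range n, l.getD i 0 = l.sum := by
  induction l generalizing n with
  | nil => simp
  | cons a t ih =>
    obtain ⟨k, rfl⟩ : ∃ k, n = k + 1 := ⟨n - 1, by simp at h; omega⟩
    rw [Finset.sum_range_succ', List.sum_cons, add_comm]
    simp only [List.getD_cons_succ, List.getD_cons_zero]
    rw [ih (by simpa using h)]

theorem sum_part {n : ℕ} (p : n.Partition) : ∑ i : Fin n, part p i = n := by
  rw [← Finset.sum_range (part p)]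
  refine (sum_range_getD_eq_sum _ (length_sortedParts_le p)).trans ?_
  rw [← Multiset.sum_coe, sortedParts, Multiset.sort_eq, p.parts_sum]

theorem part_eq_zero {n : ℕ} (p : n.Partition) {i : ℕ} (hi : n ≤ i) : part p i = 0 :=
  List.getD_eq_default _ _ ((length_sortedParts_le p).trans hi)

/-- A partition of `n` is determined by its first `n` parts. -/
theorem partition_ext_part {n : ℕ} {p q : n.Partition} (h : ∀ i : Fin n, part p i = part q i) :
    p = q := by
  have hd : diagram p = diagram q := by
    ext ⟨i, j⟩
    rw [YoungDiagram.mem_cells, YoungDiagram.mem_cells, YoungDiagram.mem_iff_lt_rowLen,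
      YoungDiagram.mem_iff_lt_rowLen, rowLen_diagram, rowLen_diagram]
    rcases lt_or_ge i n with hi | hi
    · rw [h ⟨i, hi⟩]
    · rw [part_eq_zero p hi, part_eq_zero q hi]
  have hs : sortedParts p = sortedParts q := by
    rw [← YoungDiagram.rowLens_ofRowLens_eq_self (hw := sortedParts_sortedGE p)
        (pos_of_mem_sortedParts p),
      ← YoungDiagram.rowLens_ofRowLens_eq_self (hw := sortedParts_sortedGE q)
        (pos_of_mem_sortedParts q)]
    exact congrArg YoungDiagram.rowLens hd
  ext1
  rw [← Multiset.sort_eq p.parts (· ≥ ·), ← Multiset.sort_eq q.parts (· ≥ ·)]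
  exact congrArg _ hs

/-- Dropping the zeros of a weakly decreasing list does not change its padding with zeros. -/
theorem getD_filter_ne_zero {l : List ℕ} (hl : l.SortedGE) (i : ℕ) :
    (l.filter (· ≠ 0)).getD i 0 = l.getD i 0 := by
  have hp := hl.pairwise
  clear hl
  induction l generalizing i with
  | nil => simp
  | cons a t ih =>
    rw [List.pairwise_cons] at hp
    by_cases ha : a = 0
    · have hz : ∀ x ∈ a :: t, x = 0 := by
        intro x hx
        rcases List.mem_cons.mp hx with rfl | hx
        · exact ha
        · have := hp.1 x hx
          omega
      have h1 : (a :: t).filter (· ≠ 0) = [] := by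
        rw [List.filter_eq_nil_iff]
        intro x hx
        simp [hz x hx]
      rw [h1, List.getD_nil]
      by_cases hi : i < (a :: t).length
      · rw [List.getD_eq_getElem _ _ hi]
        exact (hz _ (List.getElem_mem hi)).symm
      · rw [List.getD_eq_default _ _ (not_lt.mp hi)]
    · rw [List.filter_cons_of_pos (by simpa using ha)]
      cases i with
      | zero => rfl
      | succ i => simpa using ih i hp.2

theorem exists_partition_part_eq {n : ℕ} (l : Fin n → ℕ) (hl : Antitone l)
    (hsum : ∑ i, l i = n) : ∃ p : n.Partition, ∀ i : Fin n, part p i = l i := by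
  have hL : (List.ofFn l).SortedGE := hl.sortedGE_ofFn
  have hLsum : ((List.ofFn l : List ℕ) : Multiset ℕ).sum = n := by
    rw [Multiset.sum_coe, List.sum_ofFn, hsum]
  refine ⟨Nat.Partition.ofSums n _ hLsum, fun i => ?_⟩
  have hs : sortedParts (Nat.Partition.ofSums n _ hLsum) = (List.ofFn l).filter (· ≠ 0) := by
    refine List.Perm.eq_of_sortedGE (sortedParts_sortedGE _) ?_ ?_
    · exact (hL.pairwise.filter _).sortedGE
    · rw [← Multiset.coe_eq_coe, sortedParts, Multiset.sort_eq, Nat.Partition.ofSums_parts,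
        Multiset.filter_coe]
  rw [part, hs, getD_filter_ne_zero hL, List.getD_eq_getElem _ _ (by simp)]
  simp

theorem strictAnti_staircase_add_part {n : ℕ} (p : n.Partition) :
    StrictAnti fun i => staircase n i + part p i := by
  intro i j hij
  have h1 := part_antitone p (show (i : ℕ) ≤ j from hij.le)
  have h2 : (i : ℕ) < j := hij
  simp only [staircase]
  omega

/-- The sum of the entries of `δ + λ` is `0 + 1 + ⋯ + n`. -/
theorem sum_staircase_add {n : ℕ} : ∑ i, staircase n i + n = ∑ k ∈ Finset.range (n + 1), k := by
  rw [Finset.sum_range_succ, ← Finset.sum_range_reflect, Finset.sum_range]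
  congr 1
  refine Finset.sum_congr rfl fun i _ => ?_
  simp only [staircase]
  omega

theorem StrictAnti.add_le_of_eq_add {n : ℕ} {b : Fin n → ℕ} (hb : StrictAnti b) (k : ℕ) :
    ∀ i j : Fin n, (j : ℕ) = i + k → b j + k ≤ b i := by
  induction k with
  | zero =>
    intro i j h
    rw [Fin.ext (show (j : ℕ) = i from h), add_zero]
  | succ k ih =>
    intro i j h
    have h1 := ih i ⟨i + k, by omega⟩ rfl
    have h2 : b j < b ⟨i + k, by omega⟩ := hb (Fin.lt_def.mpr (by simp only; omega))
    omega

/-- Strictly decreasing vectors with the right sum are of the form `δ + λ`. -/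
theorem exists_partition_staircase_add_part_eq {n : ℕ} {b : Fin n → ℕ} (hb : StrictAnti b)
    (hsum : ∑ i, b i = ∑ k ∈ Finset.range (n + 1), k) :
    ∃ p : n.Partition, (fun i => staircase n i + part p i) = b := by
  have hle : ∀ i, staircase n i ≤ b i := by
    intro i
    have := hb.add_le_of_eq_add (n - (i + 1)) i ⟨n - 1, by have := i.2; omega⟩ (by simp only; omega)
    simp only [staircase]
    omega
  have hanti : Antitone fun i => b i - staircase n i := by
    intro i j hij
    have h1 : (i : ℕ) ≤ j := hij
    have h2 := hb.add_le_of_eq_add (j - i) i j (by omega)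
    simp only [staircase]
    omega
  obtain ⟨p, hp⟩ := exists_partition_part_eq _ hanti (by
    have h1 : ∑ i, (b i - staircase n i) + ∑ i, staircase n i = ∑ i, b i := by
      rw [← Finset.sum_add_distrib]
      exact Finset.sum_congr rfl fun i _ => Nat.sub_add_cancel (hle i)
    have h2 := sum_staircase_add (n := n)
    omega)
  refine ⟨p, funext fun i => ?_⟩
  have := hle i
  simp only [hp]
  omega

/-- With `b = δ + λ`, the differences `b_i - b_j` for `j > i` and the hook lengths in row `i` together
are the numbers `1, …, b_i`. -/
theorem prod_hookLength_row_mul_prod_sub {n : ℕ} (p : n.Partition) (i : Fin n) :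
    (∏ c ∈ Finset.range (part p i), hookLength (diagram p) (i, c)) *
        ∏ j ∈ Finset.Ioi i, (staircase n i + part p i - (staircase n j + part p j)) =
      (staircase n i + part p i).factorial := by
  set b : Fin n → ℕ := fun i => staircase n i + part p i with hb
  have hanti : StrictAnti b := strictAnti_staircase_add_part p
  have hbv : ∀ j, b j = n - (j + 1) + part p j := fun j => rfl
  have hmem : ∀ r c, c < part p r ↔ r < (diagram p).colLen c := fun r c => by
    rw [← rowLen_diagram, ← YoungDiagram.mem_iff_lt_rowLen, YoungDiagram.mem_iff_lt_colLen]
  have hcol : ∀ c, (diagram p).colLen c ≤ n := fun c => by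
    have := (hmem n c).not.mp (by simp [part_eq_zero p le_rfl])
    omega
  -- The hook length of the cell `(i, c)` is `b i - g c`, so that the hook lengths correspond to the
  -- values of `g` and the differences `b i - b j` to the values of `b`. As `i < colLen c` holds exactly
  -- for the cells `(i, c)`, the two sets of values are disjoint, and they fill `{0, …, b i - 1}`.
  set g : ℕ → ℕ := fun c => c + (n - (diagram p).colLen c) with hg
  have hgmono : StrictMono g := fun c c' h => by
    have := (diagram p).colLen_anti c c' h.le
    simp only [hg]
    omega
  have hdisj : Disjoint ((Finset.range (part p i)).image g) ((Finset.Ioi i).image b) := by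
    rw [Finset.disjoint_left]
    intro x hx hx'
    obtain ⟨c, -, rfl⟩ := Finset.mem_image.mp hx
    obtain ⟨j, -, hj⟩ := Finset.mem_image.mp hx'
    have h1 := hmem j c
    have h2 := hcol c
    have h3 := j.2
    rw [hbv] at hj
    simp only [hg] at hj
    omega
  have hunion : (Finset.range (part p i)).image g ∪ (Finset.Ioi i).image b =
      Finset.range (b i) := by
    refine Finset.eq_of_subset_of_card_le ?_ ?_
    · intro x hx
      rw [Finset.mem_range]
      rcases Finset.mem_union.mp hx with hx | hx
      · obtain ⟨c, hc, rfl⟩ := Finset.mem_image.mp hx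
        have h1 := hmem i c
        have h2 := Finset.mem_range.mp hc
        have h3 := hcol c
        rw [hbv]
        simp only [hg]
        omega
      · obtain ⟨j, hj, rfl⟩ := Finset.mem_image.mp hx
        exact hanti (Finset.mem_Ioi.mp hj)
    · rw [Finset.card_union_of_disjoint hdisj, Finset.card_image_of_injective _ hgmono.injective,
        Finset.card_image_of_injective _ hanti.injective, Finset.card_range, Finset.card_range,
        Fin.card_Ioi, hbv]
      omega
  change _ * ∏ j ∈ Finset.Ioi i, (b i - b j) = (b i).factorial
  rw [← Nat.descFactorial_self, Nat.descFactorial_eq_prod_range, ← hunion,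
    Finset.prod_union hdisj, Finset.prod_image hgmono.injective.injOn,
    Finset.prod_image hanti.injective.injOn]
  congr 1
  refine Finset.prod_congr rfl fun c hc => ?_
  have h1 := hmem i c
  have h2 := Finset.mem_range.mp hc
  have h3 := hcol c
  rw [hookLength, rowLen_diagram, hbv]
  simp only [hg]
  omega

/-- The hook product in terms of `b = δ + λ` (Frobenius' formula for the number of standard tableaux,
in product form). -/
theorem hookProd_mul_prod_sub {n : ℕ} (p : n.Partition) :
    hookProd p * ∏ i : Fin n, ∏ j ∈ Finset.Ioi i,
        (staircase n i + part p i - (staircase n j + part p j)) =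
      ∏ i : Fin n, (staircase n i + part p i).factorial := by
  have h : hookProd p = ∏ i : Fin n, ∏ c ∈ Finset.range (part p i),
      hookLength (diagram p) (i, c) := by
    rw [hookProd, Finset.prod_finset_product _ (Finset.range n)
      (fun i => Finset.range (part p i)) ?_, Finset.prod_range]
    rintro ⟨i, j⟩
    rw [YoungDiagram.mem_cells, YoungDiagram.mem_iff_lt_rowLen, rowLen_diagram, Finset.mem_range,
      Finset.mem_range, iff_and_self]
    intro hj
    by_contra hi
    rw [part_eq_zero p (not_lt.mp hi)] at hj
    exact absurd hj (Nat.not_lt_zero j)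
  rw [h, ← Finset.prod_mul_distrib]
  exact Finset.prod_congr rfl fun i _ => prod_hookLength_row_mul_prod_sub p i

/-! ### Coefficients of alternants -/

/-- The Vandermonde determinant of Mathlib and the product `∏_{i < j} (y_i - y_j)` differ by a sign. -/
theorem prod_sub_comm {R : Type*} [CommRing R] {n : ℕ} (f : Fin n → R) :
    ∏ i : Fin n, ∏ j ∈ Finset.Ioi i, (f j - f i) =
      (∏ i : Fin n, (-1) ^ (Finset.Ioi i).card) *
        ∏ i : Fin n, ∏ j ∈ Finset.Ioi i, (f i - f j) := by
  rw [← Finset.prod_mul_distrib]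
  refine Finset.prod_congr rfl fun i _ => ?_
  rw [← Finset.prod_neg]
  exact Finset.prod_congr rfl fun j _ => (neg_sub _ _).symm

/-- A vector is a rearrangement of at most one strictly decreasing vector, in at most one way. -/
theorem StrictAnti.perm_unique {α : Type*} [LinearOrder α] {n : ℕ} {a b : Fin n → α}
    (ha : StrictAnti a) (hb : StrictAnti b) {σ τ : Equiv.Perm (Fin n)} (h : a ∘ σ = b ∘ τ) :
    a = b ∧ σ = τ := by
  have hab : a = b := by
    have h1 : (b ∘ τ) ∘ σ.symm = a := by
      rw [← h]
      ext i
      simp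
    have h2 : (b ∘ τ) ∘ τ.symm = b := by
      ext i
      simp
    have h3 := Tuple.unique_monotone (f := OrderDual.toDual ∘ b ∘ τ) (σ := σ.symm) (τ := τ.symm)
      (by rw [Function.comp_assoc, h1]; exact ha.antitone.dual_right)
      (by rw [Function.comp_assoc, h2]; exact hb.antitone.dual_right)
    rw [Function.comp_assoc, h1, Function.comp_assoc, h2] at h3
    exact funext fun i => OrderDual.toDual.injective (congrFun h3 i)
  subst hab
  exact ⟨rfl, Equiv.ext fun i => ha.injective (congrFun h i)⟩

theorem exists_perm_strictAnti_comp {α : Type*} [LinearOrder α] {n : ℕ} {m : Fin n → α}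
    (hm : Function.Injective m) : ∃ (b : Fin n → α) (σ : Equiv.Perm (Fin n)),
      StrictAnti b ∧ b ∘ σ = m := by
  set s := Tuple.sort (OrderDual.toDual ∘ m) with hs
  have h : Antitone (m ∘ s) := fun i j hij => Tuple.monotone_sort (OrderDual.toDual ∘ m) hij
  refine ⟨m ∘ s, s.symm, h.strictAnti_of_injective (hm.comp s.injective), ?_⟩
  ext i
  simp

theorem coeff_alternant (K : Type*) [Field K] {n : ℕ} (a : Fin n → ℕ) (m : Fin n →₀ ℕ) :
    MvPolynomial.coeff m (alternant K a) =
      ∑ σ : Equiv.Perm (Fin n), if a ∘ σ = m then ((Equiv.Perm.sign σ : ℤ) : K) else 0 := by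
  rw [alternant, Matrix.det_apply', MvPolynomial.coeff_sum,
    ← Equiv.sum_comp (Equiv.inv (Equiv.Perm (Fin n)))]
  refine Finset.sum_congr rfl fun σ _ => ?_
  have h := prod_X_pow_perm (R := K) σ⁻¹ a
  simp only [Matrix.of_apply, Equiv.inv_apply]
  rw [h, ← map_intCast (MvPolynomial.C (R := K)), MvPolynomial.coeff_C_mul,
    MvPolynomial.coeff_monomial, Equiv.Perm.sign_inv, mul_ite, mul_one, mul_zero]
  refine if_congr ?_ rfl rfl
  rw [← DFunLike.coe_injective.eq_iff]
  rfl

theorem coeff_alternant_comp (K : Type*) [Field K] {n : ℕ} {a b : Fin n → ℕ} (ha : StrictAnti a)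
    (hb : StrictAnti b) (τ : Equiv.Perm (Fin n)) {m : Fin n →₀ ℕ} (hm : b ∘ τ = m) :
    MvPolynomial.coeff m (alternant K a) =
      if a = b then ((Equiv.Perm.sign τ : ℤ) : K) else 0 := by
  rw [coeff_alternant]
  split_ifs with hab
  · subst hab
    rw [Finset.sum_eq_single τ, if_pos hm]
    · intro σ _ hne
      exact if_neg fun h => hne (ha.perm_unique hb (h.trans hm.symm)).2
    · simp
  · exact Finset.sum_eq_zero fun σ _ =>
      if_neg fun h => hab (ha.perm_unique hb (h.trans hm.symm)).1

theorem staircase_add_part_injective {n : ℕ} :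
    Function.Injective fun (p : n.Partition) (i : Fin n) => staircase n i + part p i :=
  fun _ _ h => partition_ext_part fun i => Nat.add_left_cancel (congrFun h i)

theorem prod_factorial_mul_shiftedHookRatio {K : Type*} [Field K] [CharZero K] {n : ℕ}
    (p : n.Partition) (u : K) :
    ((∏ i : Fin n, (staircase n i + part p i).factorial : ℕ) : K) * shiftedHookRatio p u =
      (∏ i : Fin n, ∏ j ∈ Finset.Ioi i,
        (((staircase n i + part p i : ℕ) : K) - ((staircase n j + part p j : ℕ) : K))) *
        ∏ i : Fin n, (((staircase n i + part p i : ℕ) : K) + u) := by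
  have hshift : shiftedProd p u = ∏ i : Fin n, (((staircase n i + part p i : ℕ) : K) + u) := by
    refine Finset.prod_congr rfl fun i _ => ?_
    rw [staircase, Nat.cast_add, Nat.cast_sub i.2]
    push_cast
    ring
  have hH : (hookProd p : K) ≠ 0 := by
    rw [Nat.cast_ne_zero, hookProd, Finset.prod_ne_zero_iff]
    exact fun c _ => Nat.succ_ne_zero _
  have hcast : ((∏ i : Fin n, ∏ j ∈ Finset.Ioi i,
      (staircase n i + part p i - (staircase n j + part p j)) : ℕ) : K) =
      ∏ i : Fin n, ∏ j ∈ Finset.Ioi i,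
        (((staircase n i + part p i : ℕ) : K) - ((staircase n j + part p j : ℕ) : K)) := by
    rw [Nat.cast_prod]
    refine Finset.prod_congr rfl fun i _ => ?_
    rw [Nat.cast_prod]
    exact Finset.prod_congr rfl fun j hj => Nat.cast_sub
      (strictAnti_staircase_add_part p (Finset.mem_Ioi.mp hj)).le
  rw [shiftedHookRatio, hshift, ← hookProd_mul_prod_sub, Nat.cast_mul, hcast]
  field_simp

/-- The coefficients of the right-hand side of the identity, times the Vandermonde determinant. -/
theorem prod_factorial_mul_coeff_sum_alternant {K : Type*} [Field K] [CharZero K] {n : ℕ} (u : K)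
    (m : Fin n →₀ ℕ) :
    ((∏ i, (m i).factorial : ℕ) : K) * ((∏ i : Fin n, (-1) ^ (Finset.Ioi i).card) *
        MvPolynomial.coeff m (∑ p : n.Partition, shiftedHookRatio p u •
          alternant K fun i => staircase n i + part p i)) =
      if ∑ i, m i = ∑ k ∈ Finset.range (n + 1), k then
        (Matrix.vandermonde fun i => (m i : K)).det * ∏ i, ((m i : K) + u) else 0 := by
  simp only [MvPolynomial.coeff_sum, MvPolynomial.coeff_smul, smul_eq_mul]
  by_cases hex : ∃ (p : n.Partition) (τ : Equiv.Perm (Fin n)),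
      (fun i => staircase n i + part p i) ∘ τ = m
  -- Here `m` is a rearrangement of `δ + λ` for a unique `λ`, whose alternant alone contributes.
  · obtain ⟨p, τ, hm⟩ := hex
    have hmi : ∀ i, m i = staircase n (τ i) + part p (τ i) := fun i => (congrFun hm i).symm
    have hsum : ∑ i, m i = ∑ k ∈ Finset.range (n + 1), k := by
      simp only [hmi]
      rw [Equiv.sum_comp τ (fun i => staircase n i + part p i), Finset.sum_add_distrib, sum_part,
        sum_staircase_add]
    rw [if_pos hsum, Finset.sum_eq_single p]
    · rw [coeff_alternant_comp K (strictAnti_staircase_add_part p)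
        (strictAnti_staircase_add_part p) τ hm, if_pos rfl]
      have hV : (Matrix.vandermonde fun i => (m i : K)).det = ((Equiv.Perm.sign τ : ℤ) : K) *
          ((∏ i : Fin n, (-1) ^ (Finset.Ioi i).card) * ∏ i : Fin n, ∏ j ∈ Finset.Ioi i,
            (((staircase n i + part p i : ℕ) : K) - ((staircase n j + part p j : ℕ) : K))) := by
        rw [← prod_sub_comm, ← Matrix.det_vandermonde, ← Matrix.det_permute]
        simp only [hmi]
        rfl
      have hu : ∏ i, ((m i : K) + u) =
          ∏ i : Fin n, (((staircase n i + part p i : ℕ) : K) + u) := by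
        simp only [hmi]
        exact Equiv.prod_comp τ fun i => ((staircase n i + part p i : ℕ) : K) + u
      have hf : ∏ i, (m i).factorial = ∏ i : Fin n, (staircase n i + part p i).factorial := by
        simp only [hmi]
        exact Equiv.prod_comp τ fun i => (staircase n i + part p i).factorial
      rw [hV, hu, hf]
      linear_combination (∏ i : Fin n, (-1) ^ (Finset.Ioi i).card) *
        ((Equiv.Perm.sign τ : ℤ) : K) * prod_factorial_mul_shiftedHookRatio p u
    · intro q _ hq
      rw [coeff_alternant_comp K (strictAnti_staircase_add_part q)
        (strictAnti_staircase_add_part p) τ hm,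
        if_neg fun h => hq (staircase_add_part_injective h), mul_zero]
    · simp
  -- No alternant contributes. A vector `m` with the right sum must then have a repeated entry, so that
  -- its Vandermonde determinant vanishes.
  · rw [Finset.sum_eq_zero, mul_zero, mul_zero]
    · symm
      rw [ite_eq_right_iff]
      intro hsum
      have hinj : ¬ Function.Injective m := fun hinj => hex <| by
        obtain ⟨b, τ, hb, hbm⟩ := exists_perm_strictAnti_comp hinj
        obtain ⟨p, hp⟩ := exists_partition_staircase_add_part_eq hb (by
          rw [← hsum, ← hbm]
          exact (Equiv.sum_comp τ b).symm)
        exact ⟨p, τ, by rw [hp, hbm]⟩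
      rw [Matrix.det_vandermonde_eq_zero_iff.mpr, zero_mul]
      simp only [Function.Injective, not_forall] at hinj
      obtain ⟨i, j, hij, hne⟩ := hinj
      exact ⟨i, j, congrArg _ hij, hne⟩
    · intro p _
      rw [coeff_alternant, Finset.sum_eq_zero, mul_zero]
      exact fun σ _ => if_neg fun h => hex ⟨p, σ, h⟩

theorem lemma2p1 {K : Type*} [Field K] [CharZero K] (n : ℕ) (u : K) :
    ∑ i ∈ Finset.range (n + 1),
        Ring.choose (u + (i : K) - 1) i •
          (MvPolynomial.psum (Fin n) K 1 ^ i * MvPolynomial.esymm (Fin n) K (n - i)) =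
      ∑ p : n.Partition, shiftedHookRatio p u • schurPoly K p := by
  have hV : (Matrix.vandermonde (MvPolynomial.X : Fin n → MvPolynomial (Fin n) K)).det =
      MvPolynomial.C (∏ i : Fin n, (-1) ^ (Finset.Ioi i).card) * vandermondeProd K n := by
    rw [Matrix.det_vandermonde, prod_sub_comm, vandermondeProd]
    simp
  have hV0 : (Matrix.vandermonde (MvPolynomial.X : Fin n → MvPolynomial (Fin n) K)).det ≠ 0 :=
    Matrix.det_vandermonde_ne_zero_iff.mpr (MvPolynomial.X_injective)
  refine mul_left_cancel₀ hV0 (MvPolynomial.ext _ _ fun m => ?_)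
  have hm : ((∏ i, (m i).factorial : ℕ) : K) ≠ 0 := by
    rw [Nat.cast_ne_zero, Finset.prod_ne_zero_iff]
    exact fun i _ => Nat.factorial_ne_zero _
  refine mul_left_cancel₀ hm ?_
  rw [prod_factorial_mul_coeff_vandermonde_mul_sum, ← prod_factorial_mul_coeff_sum_alternant, hV,
    mul_assoc, MvPolynomial.coeff_C_mul, Finset.mul_sum]
  simp only [mul_smul_comm, vandermondeProd_mul_schurPoly]
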